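/- Let $\Sigma$ be a connected smooth surface, let $f:\Sigma\to\mathbb{R}^3$ be a smooth immersion with smooth Gauss map $N:\Sigma\to S^2$ (so $N\cdot \mathrm{d}f=0$), and let $\mathrm{II}=-\mathrm{d}f\cdot \mathrm{d}N$ be its second fundamental form. Let $S=-(\mathrm{d}f)^{-1}\circ \mathrm{d}N$ be its shape operator and let $K=\det S$, the product of the principal curvatures, be its Gauss curvature. Suppose that $K<0$ everywhere, so that $\mathrm{II}$ is a pseudo-Riemannian metric of signature $(1,1)$ on $\Sigma$. Then the following are equivalent: (a) $K$ is constant. (b) $N:(\Sigma,\mathrm{II})\to S^2$ is a harmonic map, i.e. its tension field $\operatorname{tr}_{\mathrm{II}}\nabla \mathrm{d}N$ vanishes. In local coordinates this says that the component tangent to $S^2$ of $\sum_{i,j}\mathrm{II}^{ij}\bigl(\partial_i\partial_j N-\sum_k\Gamma^k_{ij}\,\partial_k N\bigr)$ vanishes, where $(\mathrm{II}^{ij})$ is the inverse of the coefficient matrix of $\mathrm{II}$ and $\Gamma^k_{ij}$ are the Christoffel symbols of the Levi-Civita connection of $\mathrm{II}$. (c) Every point of $\Sigma$ has a neighbourhood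 with Tchebyshev coordinates for $f$, i.e. smooth coordinates $(\xi,\eta)$ that are asymptotic, $N_\xi\cdot f_\xi=0=N_\eta\cdot f_\eta$, and satisfy $\Vert f_\xi\Vert=1=\Vert f_\eta\Vert$. -/

import Mathlib

open scoped Manifold ContDiff

noncomputable section

namespace KSurface

/-- The Euclidean plane, the model space of surfaces. -/
abbrev E2 : Type := EuclideanSpace ℝ (Fin 2)

/-- Euclidean three-space. -/
abbrev E3 : Type := EuclideanSpace ℝ (Fin 3)

/-- The unit sphere in Euclidean three-space. -/
abbrev S2 : Type := Metric.sphere (0 : E3) 1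

/-! ### Immersed surfaces, their Gauss maps and fundamental forms -/

section Surface

variable {M : Type*} [TopologicalSpace M] [ChartedSpace E2 M]

/-- The differential at `p` of a map from a surface to Euclidean three-space. -/
def diffAt (f : M → E3) (p : M) : TangentSpace (𝓡 2) p →L[ℝ] E3 :=
  mfderiv (𝓡 2) 𝓘(ℝ, E3) f p

/-- `f` is a smooth immersion. -/
structure IsSmoothImmersion (f : M → E3) : Prop where
  smooth : ContMDiff (𝓡 2) 𝓘(ℝ, E3) ∞ f
  injective : ∀ p, Function.Injective (diffAt f p)

/-- A map to the unit sphere, regarded as a map to Euclidean three-space. -/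
def toE3 (N : M → S2) : M → E3 := fun p => (N p : E3)

/-- `N` is a Gauss map of `f`: a smooth unit vector field along `f` with `N · df = 0`. -/
structure IsGaussMap (f : M → E3) (N : M → S2) : Prop where
  smooth : ContMDiff (𝓡 2) 𝓘(ℝ, E3) ∞ (toE3 N)
  normal : ∀ p (v : TangentSpace (𝓡 2) p), inner ℝ (toE3 N p) (diffAt f p v) = 0

/-- The second fundamental form `II = - df · dN`. -/
def secondForm (f : M → E3) (N : M → S2) (p : M) (v w : TangentSpace (𝓡 2) p) : ℝ :=
  - inner ℝ (diffAt f p v) (diffAt (toE3 N) p w)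

open Classical in
/-- The shape operator `S = - (df)⁻¹ ∘ dN`, i.e. the endomorphism of the tangent plane with
`df ∘ S = - dN`. It exists and is unique for an immersion with its Gauss map; the value `0` is
used when there is no such endomorphism. -/
def shapeOperator (f : M → E3) (N : M → S2) (p : M) :
    TangentSpace (𝓡 2) p →ₗ[ℝ] TangentSpace (𝓡 2) p :=
  if h : ∃ S : TangentSpace (𝓡 2) p →ₗ[ℝ] TangentSpace (𝓡 2) p,
      ∀ v, diffAt f p (S v) = - diffAt (toE3 N) p v
  then h.choose else 0

/-- The Gauss curvature `K = κ₁ κ₂`, the product of the two eigenvalues of the shape operator,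
i.e. its determinant. -/
def gaussCurvature (f : M → E3) (N : M → S2) (p : M) : ℝ :=
  LinearMap.det (shapeOperator f N p)

theorem inner_toE3_diffAt {f : M → E3} {N : M → S2} (hN : IsGaussMap f N) (p : M)
    (v : TangentSpace (𝓡 2) p) : inner ℝ (toE3 N p) (diffAt (toE3 N) p v) = 0 := by
  have hd : MDifferentiableAt (𝓡 2) 𝓘(ℝ, E3) (toE3 N) p :=
    (hN.smooth p).mdifferentiableAt (by simp)
  have hin : HasFDerivAt (fun y : E3 => inner ℝ y y) _ (toE3 N p) :=
    (hasFDerivAt_id (toE3 N p)).inner ℝ (hasFDerivAt_id (toE3 N p))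
  have hc := hin.hasMFDerivAt.comp p hd.hasMFDerivAt
  have he : ((fun y : E3 => inner ℝ y y) ∘ toE3 N) = fun _ => (1 : ℝ) := by
    funext q
    have : ‖toE3 N q‖ = 1 := by simp [toE3]
    simp [this]
  rw [he] at hc
  have h0 := hasMFDerivAt_unique hc (hasMFDerivAt_const (1 : ℝ) p)
  have h1 := congrArg (fun L => L v) h0
  have h2 : inner ℝ (toE3 N p) (diffAt (toE3 N) p v)
      + inner ℝ (diffAt (toE3 N) p v) (toE3 N p) = 0 := by
    exact h1
  rw [real_inner_comm (toE3 N p)] at h2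
  linarith

theorem diffAt_shapeOperator {f : M → E3} {N : M → S2} (hf : IsSmoothImmersion f)
    (hN : IsGaussMap f N) (p : M) (v : TangentSpace (𝓡 2) p) :
    diffAt f p (shapeOperator f N p v) = - diffAt (toE3 N) p v := by
  have hex : ∃ S : TangentSpace (𝓡 2) p →ₗ[ℝ] TangentSpace (𝓡 2) p,
      ∀ v, diffAt f p (S v) = - diffAt (toE3 N) p v := by
    have hn : toE3 N p ≠ 0 := by
      intro h
      have : ‖toE3 N p‖ = 1 := by simp [toE3]
      simp [h] at this
    let D : E2 →ₗ[ℝ] E3 := (diffAt f p).toLinearMap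
    have hinj : Function.Injective D := hf.injective p
    have hr : LinearMap.range D = (ℝ ∙ toE3 N p)ᗮ := by
      apply Submodule.eq_of_le_of_finrank_eq
      · rintro _ ⟨w, rfl⟩
        rw [Submodule.mem_orthogonal_singleton_iff_inner_right]
        exact hN.normal p w
      · rw [LinearMap.finrank_range_of_inj hinj]
        have h3 := Submodule.finrank_add_finrank_orthogonal (ℝ ∙ toE3 N p)
        rw [finrank_span_singleton hn] at h3
        simp at h3 ⊢
        omega
    let B : E2 →ₗ[ℝ] E3 := (diffAt (toE3 N) p).toLinearMap
    have hB : ∀ w, B w ∈ LinearMap.range D := fun w => by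
      rw [hr, Submodule.mem_orthogonal_singleton_iff_inner_right]
      exact inner_toE3_diffAt hN p w
    refine ⟨-((LinearEquiv.ofInjective D hinj).symm.toLinearMap ∘ₗ B.codRestrict _ hB),
      fun w => ?_⟩
    have := congrArg Subtype.val
      ((LinearEquiv.ofInjective D hinj).apply_symm_apply (B.codRestrict _ hB w))
    change D (-((LinearEquiv.ofInjective D hinj).symm (B.codRestrict _ hB w))) = - B w
    rw [map_neg]
    exact congrArg Neg.neg this
  unfold shapeOperator
  rw [dif_pos hex]
  exact hex.choose_spec v

end Surface

/-! ### Local coordinates and harmonic maps to the sphere -/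

section Coordinates

/-- The partial derivative in the `i`-th coordinate direction of the plane. -/
def pd {F : Type*} [NormedAddCommGroup F] [NormedSpace ℝ F] (i : Fin 2) (u : E2 → F) (x : E2) :
    F :=
  fderiv ℝ u x (EuclideanSpace.single i 1)

/-- The Christoffel symbols `Γᵏᵢⱼ` of the Levi-Civita connection of the (pseudo-)Riemannian metric
with coefficient matrix `G`. -/
def christoffel (G : E2 → Matrix (Fin 2) (Fin 2) ℝ) (k i j : Fin 2) (x : E2) : ℝ :=
  (1 / 2) * ∑ l, (G x)⁻¹ k l *
    (pd i (fun y => G y j l) x + pd j (fun y => G y i l) x - pd l (fun y => G y i j) x)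

/-- The trace `∑ Gⁱʲ (∂ᵢ ∂ⱼ u - Γᵏᵢⱼ ∂ₖ u)` of the Hessian of a vector-valued function `u`, with
respect to the metric with coefficient matrix `G`. -/
def traceHessian (G : E2 → Matrix (Fin 2) (Fin 2) ℝ) (u : E2 → E3) (x : E2) : E3 :=
  ∑ i, ∑ j, (G x)⁻¹ i j • (pd i (pd j u) x - ∑ k, christoffel G k i j x • pd k u x)

variable {M : Type*} [TopologicalSpace M] [ChartedSpace E2 M]

/-- The coefficient matrix, in the coordinates given by the chart `e`, of a field `g` of bilinear
forms on the tangent planes. -/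
def coordMatrix (g : ∀ p : M, TangentSpace (𝓡 2) p → TangentSpace (𝓡 2) p → ℝ)
    (e : OpenPartialHomeomorph M E2) (x : E2) : Matrix (Fin 2) (Fin 2) ℝ :=
  Matrix.of fun i j =>
    g (e.symm x) (mfderiv 𝓘(ℝ, E2) (𝓡 2) e.symm x (EuclideanSpace.single i 1))
      (mfderiv 𝓘(ℝ, E2) (𝓡 2) e.symm x (EuclideanSpace.single j 1))

/-- The tension field `tr_g ∇dφ` of a map `φ` from a surface with (pseudo-)Riemannian metric `g` to
the unit sphere, at the point with coordinates `x` in the chart `e`. As the Levi-Civita connection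
of the sphere is the tangential part of the flat connection of the ambient space, it is the
tangential part of the trace of the Hessian of the vector-valued function `φ`. -/
def tension (g : ∀ p : M, TangentSpace (𝓡 2) p → TangentSpace (𝓡 2) p → ℝ) (φ : M → S2)
    (e : OpenPartialHomeomorph M E2) (x : E2) : E3 :=
  traceHessian (coordMatrix g e) (toE3 φ ∘ e.symm) x
    - inner ℝ (toE3 φ (e.symm x)) (traceHessian (coordMatrix g e) (toE3 φ ∘ e.symm) x)
      • toE3 φ (e.symm x)

/-- The map `φ : (M, g) → S²` is harmonic: its tension field vanishes (in all smooth charts). -/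
def IsHarmonic (g : ∀ p : M, TangentSpace (𝓡 2) p → TangentSpace (𝓡 2) p → ℝ) (φ : M → S2) :
    Prop :=
  ∀ e ∈ IsManifold.maximalAtlas (𝓡 2) ∞ M, ∀ x ∈ e.target, tension g φ e x = 0

/-- The coordinates `(ξ, η)` given by the chart `e` are asymptotic for `f`:
`N_ξ · f_ξ = 0 = N_η · f_η`. -/
def IsAsymptotic (f : M → E3) (N : M → S2) (e : OpenPartialHomeomorph M E2) : Prop :=
  ∀ x ∈ e.target, ∀ i : Fin 2,
    inner ℝ (pd i (toE3 N ∘ e.symm) x) (pd i (f ∘ e.symm) x) = 0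

/-- The coordinates `(ξ, η)` given by the chart `e` are Tchebyshev for `f`: they are asymptotic and
`‖f_ξ‖ = 1 = ‖f_η‖`. -/
def IsTchebyshev (f : M → E3) (N : M → S2) (e : OpenPartialHomeomorph M E2) : Prop :=
  IsAsymptotic f N e ∧ ∀ x ∈ e.target, ∀ i : Fin 2, ‖pd i (f ∘ e.symm) x‖ = 1

end Coordinates

end KSurface

end

noncomputable section

namespace KSurface

/-! ### Calculus of partial derivatives -/

section PartialDerivatives

variable {F : Type*} [NormedAddCommGroup F] [NormedSpace ℝ F]

/-! In a chart write F, n, k for the immersion, the Gauss map and K. Every condition is compared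
with dK = 0, which on a connected surface means K constant.

Harmonicity. Lowering the index of the Christoffel symbols of II and using the symmetry of II gives
⟨F_l, ∇_i∂_j n⟩ = ½(⟨F_j, n_li⟩ - ⟨F_li, n_j⟩). Differentiating det II = k det I produces the same
differences, so tracing yields ⟨F_l, tr_II ∇dn⟩ = -∂_l k / (2k) (`inner_traceHessian`). Pairing with
F_0 and F_1 determines a tangent vector, so the tension field vanishes exactly where dk does.

From Tchebyshev coordinates to constant K. Unit lengths make F_ξη normal, hence orthogonal to dn.
With the vanishing diagonal of II, this cancels every term in the formula for dk
(`pd_curvature_of_tchebyshev`).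

From constant K to Tchebyshev coordinates. Take r constant with r²K = -1. The vector-valued forms A±
= dF ± r n × dn have rank one, so locally A+ = 2αu and A- = 2βv with unit fields u, v. Since d(n ×
dn) is normal, dA± has no tangential part; pairing it with the unit field shows that α and β are
closed (`exists_closed_form`). Potentials ξ, η of α and β are coordinates because F is immersed, and
dF = u dξ + v dη, r n × dn = u dξ - v dη. Thus F_ξ = u and F_η = v have length one, and F_ξ = r n ×
n_ξ, F_η = -r n × n_η are orthogonal to n_ξ, n_η. -/

theorem pd_congr {u v : E2 → F} {x : E2} (h : u =ᶠ[nhds x] v) (i : Fin 2) :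
    pd i u x = pd i v x := by
  simp only [pd, h.fderiv_eq]

theorem pd_congr_of_eqOn {U : Set E2} (hU : IsOpen U) {u v : E2 → F} (h : Set.EqOn u v U)
    {x : E2} (hx : x ∈ U) (i : Fin 2) : pd i u x = pd i v x :=
  pd_congr (h.eventuallyEq_of_mem (hU.mem_nhds hx)) i

theorem contDiffOn_pd {U : Set E2} (hU : IsOpen U) {u : E2 → F} (hu : ContDiffOn ℝ ∞ u U)
    (i : Fin 2) : ContDiffOn ℝ ∞ (pd i u) U :=
  (hu.fderiv_of_isOpen hU (m := ∞) (by simp)).clm_apply contDiffOn_const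

theorem differentiableAt_of_contDiffOn {U : Set E2} (hU : IsOpen U) {u : E2 → F}
    (hu : ContDiffOn ℝ ∞ u U) {x : E2} (hx : x ∈ U) : DifferentiableAt ℝ u x :=
  (hu.contDiffAt (hU.mem_nhds hx)).differentiableAt (by simp)

theorem pd_comm {U : Set E2} (hU : IsOpen U) {u : E2 → F} (hu : ContDiffOn ℝ ∞ u U)
    {x : E2} (hx : x ∈ U) (i j : Fin 2) : pd i (pd j u) x = pd j (pd i u) x := by
  have hd : DifferentiableAt ℝ (fderiv ℝ u) x :=
    differentiableAt_of_contDiffOn hU (hu.fderiv_of_isOpen hU (m := ∞) (by simp)) hx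
  have key : ∀ a b : Fin 2, pd a (pd b u) x =
      fderiv ℝ (fderiv ℝ u) x (EuclideanSpace.single a 1) (EuclideanSpace.single b 1) := by
    intro a b
    change fderiv ℝ (fun y => fderiv ℝ u y (EuclideanSpace.single b 1)) x _ = _
    rw [fderiv_clm_apply hd (differentiableAt_const _)]
    simp
  have hs : IsSymmSndFDerivAt ℝ u x :=
    (hu.contDiffAt (hU.mem_nhds hx)).isSymmSndFDerivAt
      (by
        rw [minSmoothness_of_isRCLikeNormedField]
        exact WithTop.coe_le_coe.2 (le_top : (2 : ℕ∞) ≤ ⊤))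
  rw [key, key, hs.eq]

theorem pd_inner {u v : E2 → E3} {x : E2} (hu : DifferentiableAt ℝ u x)
    (hv : DifferentiableAt ℝ v x) (i : Fin 2) :
    pd i (fun y => inner ℝ (u y) (v y)) x
      = inner ℝ (u x) (pd i v x) + inner ℝ (pd i u x) (v x) := by
  simp only [pd]
  rw [fderiv_inner_apply ℝ hu hv]

theorem pd_const (c : F) (i : Fin 2) (x : E2) : pd i (fun _ => c) x = 0 := by
  simp [pd]

theorem pd_add {u v : E2 → F} {x : E2} (hu : DifferentiableAt ℝ u x)
    (hv : DifferentiableAt ℝ v x) (i : Fin 2) :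
    pd i (fun y => u y + v y) x = pd i u x + pd i v x := by
  simp only [pd]
  rw [fderiv_fun_add hu hv]; rfl

theorem pd_sub {u v : E2 → F} {x : E2} (hu : DifferentiableAt ℝ u x)
    (hv : DifferentiableAt ℝ v x) (i : Fin 2) :
    pd i (fun y => u y - v y) x = pd i u x - pd i v x := by
  simp only [pd]
  rw [fderiv_fun_sub hu hv]; rfl

theorem pd_neg {u : E2 → F} {x : E2} (i : Fin 2) :
    pd i (fun y => - u y) x = - pd i u x := by
  simp only [pd]
  rw [fderiv_fun_neg]; rfl

theorem pd_mul {u v : E2 → ℝ} {x : E2} (hu : DifferentiableAt ℝ u x)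
    (hv : DifferentiableAt ℝ v x) (i : Fin 2) :
    pd i (fun y => u y * v y) x = u x * pd i v x + pd i u x * v x := by
  simp only [pd]
  rw [fderiv_fun_mul hu hv]
  simp [mul_comm]

theorem pd_const_smul {u : E2 → F} {x : E2} (hu : DifferentiableAt ℝ u x) (c : ℝ) (i : Fin 2) :
    pd i (fun y => c • u y) x = c • pd i u x := by
  simp only [pd]
  rw [fderiv_fun_const_smul hu]; rfl

/-- A linear map on the plane is determined by its values on the two basis vectors. -/
theorem clm_apply_eq (L : E2 →L[ℝ] F) (v : E2) :
    L v = v 0 • L (EuclideanSpace.single 0 1) + v 1 • L (EuclideanSpace.single 1 1) := by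
  have hv : v = v 0 • EuclideanSpace.single 0 (1 : ℝ) + v 1 • EuclideanSpace.single 1 (1 : ℝ) := by
    ext i; fin_cases i <;> simp
  conv_lhs => rw [hv]
  simp

theorem fderiv_eq_zero_of_pd {u : E2 → F} {x : E2} (h : ∀ i, pd i u x = 0) :
    fderiv ℝ u x = 0 := by
  ext v
  rw [clm_apply_eq]
  have h0 := h 0
  have h1 := h 1
  simp only [pd] at h0 h1
  simp [h0, h1]

end PartialDerivatives

/-! ### The cross product -/

section Cross

/-- The cross product of Euclidean three-space, as a continuous bilinear map. -/
def cross : E3 →L[ℝ] E3 →L[ℝ] E3 :=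
  (LinearMap.mk₂ ℝ
    (fun a b : E3 => (!₂[a 1 * b 2 - a 2 * b 1, a 2 * b 0 - a 0 * b 2,
      a 0 * b 1 - a 1 * b 0] : E3))
    (fun a a' b => by ext i; fin_cases i <;> simp <;> ring)
    (fun c a b => by ext i; fin_cases i <;> simp <;> ring)
    (fun a b b' => by ext i; fin_cases i <;> simp <;> ring)
    (fun c a b => by ext i; fin_cases i <;> simp <;> ring)).toContinuousBilinearMap

theorem cross_apply_zero (a b : E3) : cross a b 0 = a 1 * b 2 - a 2 * b 1 := rfl
theorem cross_apply_one (a b : E3) : cross a b 1 = a 2 * b 0 - a 0 * b 2 := rfl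
theorem cross_apply_two (a b : E3) : cross a b 2 = a 0 * b 1 - a 1 * b 0 := rfl

theorem inner_eq (a b : E3) : inner ℝ a b = a 0 * b 0 + a 1 * b 1 + a 2 * b 2 := by
  simp [PiLp.inner_apply, Fin.sum_univ_three, mul_comm]

theorem cross_anticomm (a b : E3) : cross a b = - cross b a := by
  ext i; fin_cases i <;> simp [cross_apply_zero, cross_apply_one, cross_apply_two] <;> ring

theorem cross_self (a : E3) : cross a a = 0 := by
  ext i; fin_cases i <;> simp [cross_apply_zero, cross_apply_one, cross_apply_two] <;> ring

theorem inner_cross_self_right (a b : E3) : inner ℝ b (cross a b) = 0 := by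
  simp only [inner_eq, cross_apply_zero, cross_apply_one, cross_apply_two]; ring

theorem inner_cross_self_left (a b : E3) : inner ℝ a (cross a b) = 0 := by
  simp only [inner_eq, cross_apply_zero, cross_apply_one, cross_apply_two]; ring

theorem inner_cross_rotate (a b c : E3) : inner ℝ a (cross b c) = inner ℝ b (cross c a) := by
  simp only [inner_eq, cross_apply_zero, cross_apply_one, cross_apply_two]; ring

theorem cross_cross (a b c : E3) :
    cross a (cross b c) = inner ℝ a c • b - inner ℝ a b • c := by
  ext i; fin_cases i <;>
    simp [inner_eq, cross_apply_zero, cross_apply_one, cross_apply_two] <;> ring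

/-- The square of the triple product is the Gram determinant; here for a unit vector `n`
orthogonal to `a` and `b`. -/
theorem inner_cross_sq {a b n : E3} (hn : inner ℝ n n = 1) (ha : inner ℝ n a = 0)
    (hb : inner ℝ n b = 0) :
    inner ℝ n (cross a b) ^ 2 = inner ℝ a a * inner ℝ b b - inner ℝ a b ^ 2 := by
  have key : inner ℝ n (cross a b) ^ 2
      = inner ℝ n n * (inner ℝ a a * inner ℝ b b - inner ℝ a b ^ 2)
        - inner ℝ n a * (inner ℝ n a * inner ℝ b b - inner ℝ n b * inner ℝ a b)
        + inner ℝ n b * (inner ℝ n a * inner ℝ a b - inner ℝ n b * inner ℝ a a) := by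
    simp only [inner_eq, cross_apply_zero, cross_apply_one, cross_apply_two]; ring
  rw [key, hn, ha, hb]; ring

/-- The Gram determinant is the square of the triple product of n, a, b, so these form a basis; t is
expanded in the reciprocal basis b × n, n × a, a × b. -/
theorem eq_zero_of_inner_eq_zero {a b n t : E3} (hn : inner ℝ n n = 1) (ha : inner ℝ n a = 0)
    (hb : inner ℝ n b = 0) (hab : inner ℝ a a * inner ℝ b b - inner ℝ a b ^ 2 ≠ 0)
    (hta : inner ℝ a t = 0) (htb : inner ℝ b t = 0) (htn : inner ℝ n t = 0) : t = 0 := by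
  have hD : inner ℝ n (cross a b) ≠ 0 := by
    intro h
    have := inner_cross_sq hn ha hb
    rw [h] at this
    exact hab (by rw [← this]; ring)
  have key : inner ℝ n (cross a b) • t
      = inner ℝ a t • cross b n + inner ℝ b t • cross n a + inner ℝ n t • cross a b := by
    ext i; fin_cases i <;>
      simp [inner_eq, cross_apply_zero, cross_apply_one, cross_apply_two] <;> ring
  rw [hta, htb, htn] at key
  simpa [hD] using key

end Cross

/-! ### Surfaces in coordinates -/

/-- The determinant of the first fundamental form in coordinates. -/
def gram (F : E2 → E3) (x : E2) : ℝ :=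
  inner ℝ (pd 0 F x) (pd 0 F x) * inner ℝ (pd 1 F x) (pd 1 F x)
    - inner ℝ (pd 0 F x) (pd 1 F x) ^ 2

/-- `F : U → ℝ³` is an immersion of an open set of the plane with Gauss map `n` and Gauss
curvature `k`. -/
structure IsCoordSurface (U : Set E2) (F n : E2 → E3) (k : E2 → ℝ) : Prop where
  isOpen : IsOpen U
  smooth_map : ContDiffOn ℝ ∞ F U
  smooth_gauss : ContDiffOn ℝ ∞ n U
  unit : ∀ x ∈ U, inner ℝ (n x) (n x) = 1
  normal : ∀ x ∈ U, ∀ i, inner ℝ (n x) (pd i F x) = 0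
  gram_ne_zero : ∀ x ∈ U, gram F x ≠ 0
  weingarten : ∀ x ∈ U, ∃ s : Matrix (Fin 2) (Fin 2) ℝ,
    (∀ j, pd j n x = - (s 0 j • pd 0 F x + s 1 j • pd 1 F x)) ∧ s.det = k x

namespace IsCoordSurface

variable {U : Set E2} {F n : E2 → E3} {k : E2 → ℝ}

theorem differentiableAt_map (h : IsCoordSurface U F n k) {x : E2} (hx : x ∈ U) :
    DifferentiableAt ℝ F x :=
  differentiableAt_of_contDiffOn h.isOpen h.smooth_map hx

theorem differentiableAt_gauss (h : IsCoordSurface U F n k) {x : E2} (hx : x ∈ U) :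
    DifferentiableAt ℝ n x :=
  differentiableAt_of_contDiffOn h.isOpen h.smooth_gauss hx

theorem differentiableAt_pd_map (h : IsCoordSurface U F n k) {x : E2} (hx : x ∈ U) (i : Fin 2) :
    DifferentiableAt ℝ (pd i F) x :=
  differentiableAt_of_contDiffOn h.isOpen (contDiffOn_pd h.isOpen h.smooth_map i) hx

theorem differentiableAt_pd_gauss (h : IsCoordSurface U F n k) {x : E2} (hx : x ∈ U) (i : Fin 2) :
    DifferentiableAt ℝ (pd i n) x :=
  differentiableAt_of_contDiffOn h.isOpen (contDiffOn_pd h.isOpen h.smooth_gauss i) hx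

theorem inner_gauss_pd_gauss (h : IsCoordSurface U F n k) {x : E2} (hx : x ∈ U) (i : Fin 2) :
    inner ℝ (n x) (pd i n x) = 0 := by
  have h1 := pd_congr_of_eqOn (v := fun _ => (1 : ℝ)) h.isOpen (fun y hy => h.unit y hy) hx i
  rw [pd_inner (h.differentiableAt_gauss hx) (h.differentiableAt_gauss hx), pd_const,
    real_inner_comm (n x) (pd i n x)] at h1
  linarith

/-- The derivative of n · F_i = 0. It turns II into a pairing of n with second derivatives of F,
whence its symmetry. -/
theorem inner_pd_pd_add (h : IsCoordSurface U F n k) {x : E2} (hx : x ∈ U) (i j : Fin 2) :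
    inner ℝ (n x) (pd j (pd i F) x) + inner ℝ (pd j n x) (pd i F x) = 0 := by
  have h1 := pd_congr_of_eqOn (v := fun _ => (0 : ℝ)) h.isOpen
    (fun y hy => h.normal y hy i) hx j
  rwa [pd_inner (h.differentiableAt_gauss hx) (h.differentiableAt_pd_map hx i), pd_const] at h1

/-- The second fundamental form is symmetric. -/
theorem inner_pd_comm (h : IsCoordSurface U F n k) {x : E2} (hx : x ∈ U) (i j : Fin 2) :
    inner ℝ (pd i F x) (pd j n x) = inner ℝ (pd j F x) (pd i n x) := by
  have h1 := h.inner_pd_pd_add hx i j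
  have h2 := h.inner_pd_pd_add hx j i
  rw [pd_comm h.isOpen h.smooth_map hx] at h1
  rw [real_inner_comm (pd j n x), real_inner_comm (pd i n x)]
  linarith

/-- The determinant of the second fundamental form is `k` times that of the first. -/
theorem det_second (h : IsCoordSurface U F n k) {x : E2} (hx : x ∈ U) :
    inner ℝ (pd 0 F x) (pd 0 n x) * inner ℝ (pd 1 F x) (pd 1 n x)
      - inner ℝ (pd 0 F x) (pd 1 n x) * inner ℝ (pd 1 F x) (pd 0 n x) = k x * gram F x := by
  obtain ⟨s, hs, hk⟩ := h.weingarten x hx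
  rw [← hk, Matrix.det_fin_two, hs 0, hs 1, gram]
  simp only [inner_neg_right, inner_add_right, inner_smul_right]
  rw [real_inner_comm (pd 0 F x) (pd 1 F x)]
  ring

theorem pd_inner_pd (h : IsCoordSurface U F n k) {x : E2} (hx : x ∈ U) (i j l : Fin 2) :
    pd l (fun y => inner ℝ (pd i F y) (pd j n y)) x
      = inner ℝ (pd i F x) (pd l (pd j n) x) + inner ℝ (pd l (pd i F) x) (pd j n x) :=
  pd_inner (h.differentiableAt_pd_map hx i) (h.differentiableAt_pd_gauss hx j) l

theorem contDiffOn_gram (h : IsCoordSurface U F n k) : ContDiffOn ℝ ∞ (gram F) U := by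
  have hi : ∀ i, ContDiffOn ℝ ∞ (pd i F) U := contDiffOn_pd h.isOpen h.smooth_map
  exact (((hi 0).inner ℝ (hi 0)).mul ((hi 1).inner ℝ (hi 1))).sub (((hi 0).inner ℝ (hi 1)).pow 2)

/-- The structure gives k only pointwise, as a determinant of some Weingarten matrix; smoothness
comes from k = det II / det I. -/
theorem contDiffOn_curvature (h : IsCoordSurface U F n k) : ContDiffOn ℝ ∞ k U := by
  have hF : ∀ i, ContDiffOn ℝ ∞ (pd i F) U := contDiffOn_pd h.isOpen h.smooth_map
  have hn : ∀ i, ContDiffOn ℝ ∞ (pd i n) U := contDiffOn_pd h.isOpen h.smooth_gauss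
  have hd := ((((hF 0).inner ℝ (hn 0)).mul ((hF 1).inner ℝ (hn 1))).sub
    (((hF 0).inner ℝ (hn 1)).mul ((hF 1).inner ℝ (hn 0)))).div h.contDiffOn_gram h.gram_ne_zero
  refine hd.congr fun x hx => ?_
  change k x = _ / gram F x
  rw [eq_div_iff (h.gram_ne_zero x hx)]
  exact (h.det_second hx).symm

theorem pd_gram (h : IsCoordSurface U F n k) {x : E2} (hx : x ∈ U) (l : Fin 2) :
    pd l (gram F) x
      = 2 * (inner ℝ (pd l (pd 0 F) x) (pd 0 F x) * inner ℝ (pd 1 F x) (pd 1 F x)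
        + inner ℝ (pd l (pd 1 F) x) (pd 1 F x) * inner ℝ (pd 0 F x) (pd 0 F x)
        - inner ℝ (pd 0 F x) (pd 1 F x) * (inner ℝ (pd l (pd 0 F) x) (pd 1 F x)
          + inner ℝ (pd l (pd 1 F) x) (pd 0 F x))) := by
  have hd := h.differentiableAt_pd_map hx
  have hg : gram F = fun y => inner ℝ (pd 0 F y) (pd 0 F y) * inner ℝ (pd 1 F y) (pd 1 F y)
      - inner ℝ (pd 0 F y) (pd 1 F y) * inner ℝ (pd 0 F y) (pd 1 F y) := by
    funext y; rw [gram]; ring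
  have h00 := (hd 0).inner ℝ (hd 0)
  have h01 := (hd 0).inner ℝ (hd 1)
  have h11 := (hd 1).inner ℝ (hd 1)
  rw [hg, pd_sub (h00.fun_mul h11) (h01.fun_mul h01), pd_mul h00 h11, pd_mul h01 h01,
    pd_inner (hd 0) (hd 0), pd_inner (hd 0) (hd 1), pd_inner (hd 1) (hd 1)]
  simp only [real_inner_comm (pd l (pd 0 F) x), real_inner_comm (pd l (pd 1 F) x)]
  ring

/-- The derivative of the curvature in terms of the second derivatives of the immersion and of
its Gauss map. -/
theorem gram_mul_pd_curvature (h : IsCoordSurface U F n k) {x : E2} (hx : x ∈ U) (l : Fin 2) :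
    gram F x * pd l k x
      = inner ℝ (pd 1 F x) (pd 1 n x)
          * (inner ℝ (pd 0 F x) (pd l (pd 0 n) x) - inner ℝ (pd l (pd 0 F) x) (pd 0 n x))
        + inner ℝ (pd 0 F x) (pd 0 n x)
          * (inner ℝ (pd 1 F x) (pd l (pd 1 n) x) - inner ℝ (pd l (pd 1 F) x) (pd 1 n x))
        - inner ℝ (pd 0 F x) (pd 1 n x)
          * (inner ℝ (pd 1 F x) (pd l (pd 0 n) x) - inner ℝ (pd l (pd 0 F) x) (pd 1 n x))
        - inner ℝ (pd 1 F x) (pd 0 n x)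
          * (inner ℝ (pd 0 F x) (pd l (pd 1 n) x) - inner ℝ (pd l (pd 1 F) x) (pd 0 n x)) := by
  have hF := h.differentiableAt_pd_map hx
  have hn := h.differentiableAt_pd_gauss hx
  have hd : ∀ i j, DifferentiableAt ℝ (fun y => inner ℝ (pd i F y) (pd j n y)) x :=
    fun i j => (hF i).inner ℝ (hn j)
  have h1 := pd_congr_of_eqOn h.isOpen (fun y hy => h.det_second hy) hx l
  rw [pd_sub ((hd 0 0).fun_mul (hd 1 1)) ((hd 0 1).fun_mul (hd 1 0)), pd_mul (hd 0 0) (hd 1 1),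
    pd_mul (hd 0 1) (hd 1 0), pd_mul
      (differentiableAt_of_contDiffOn h.isOpen h.contDiffOn_curvature hx)
      (differentiableAt_of_contDiffOn h.isOpen h.contDiffOn_gram hx), h.pd_gram hx,
    h.pd_inner_pd hx, h.pd_inner_pd hx, h.pd_inner_pd hx, h.pd_inner_pd hx] at h1
  -- The symmetry of II, multiplied by the factor with which it enters once the derivatives of n are
  -- replaced by the Weingarten equations.
  have hsym : (inner ℝ (pd 0 F x) (pd 1 n x) - inner ℝ (pd 1 F x) (pd 0 n x))
      * (inner ℝ (pd l (pd 0 F) x) (pd 1 n x) - inner ℝ (pd l (pd 1 F) x) (pd 0 n x)) = 0 := by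
    rw [h.inner_pd_comm hx 0 1]; ring
  obtain ⟨s, hs, hk⟩ := h.weingarten x hx
  rw [Matrix.det_fin_two] at hk
  rw [← hk] at h1
  simp only [hs 0, hs 1, inner_neg_right, inner_add_right, inner_smul_right] at h1 hsym ⊢
  rw [real_inner_comm (pd 0 F x) (pd 1 F x)] at *
  linear_combination -h1 - hsym

end IsCoordSurface

/-! ### The tension field of the Gauss map in coordinates -/

/-- Lowering the upper index cancels the inverse matrix. Only nondegeneracy is needed, so an
indefinite metric is allowed. -/
theorem sum_mul_christoffel {G : E2 → Matrix (Fin 2) (Fin 2) ℝ} {x : E2} (hG : (G x).det ≠ 0)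
    (l i j : Fin 2) :
    ∑ k, G x l k * christoffel G k i j x
      = (1 / 2) * (pd i (fun y => G y j l) x + pd j (fun y => G y i l) x
        - pd l (fun y => G y i j) x) := by
  have h1 : G x * (G x)⁻¹ = 1 := Matrix.mul_nonsing_inv _ (isUnit_iff_ne_zero.2 hG)
  have h2 : ∀ w : Fin 2 → ℝ, G x l 0 * ((G x)⁻¹ 0 0 * w 0 + (G x)⁻¹ 0 1 * w 1)
      + G x l 1 * ((G x)⁻¹ 1 0 * w 0 + (G x)⁻¹ 1 1 * w 1) = w l := by
    intro w
    have h3 := congrFun (congrArg (fun A : Matrix (Fin 2) (Fin 2) ℝ => A.mulVec w) h1) l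
    simp only [Matrix.one_mulVec, ← Matrix.mulVec_mulVec] at h3
    simpa [Matrix.mulVec, dotProduct, Fin.sum_univ_two] using h3
  have h3 := h2 fun l => pd i (fun y => G y j l) x + pd j (fun y => G y i l) x
    - pd l (fun y => G y i j) x
  simp only [christoffel, Fin.sum_univ_two] at h3 ⊢
  rw [← h3]
  ring

namespace IsCoordSurface

variable {U : Set E2} {F n : E2 → E3} {k : E2 → ℝ} {G : E2 → Matrix (Fin 2) (Fin 2) ℝ}

theorem det_eq (h : IsCoordSurface U F n k)
    (hG : ∀ y ∈ U, ∀ i j, G y i j = - inner ℝ (pd i F y) (pd j n y)) {x : E2} (hx : x ∈ U) :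
    (G x).det = k x * gram F x := by
  rw [Matrix.det_fin_two, ← h.det_second hx]
  simp only [hG x hx]
  ring

/-- Pairing with F_l lowers the Christoffel index, since ⟨F_l, n_m⟩ = -G_lm. The product rule on the
three derivatives of G then cancels all but two terms. -/
theorem inner_hessian (h : IsCoordSurface U F n k)
    (hG : ∀ y ∈ U, ∀ i j, G y i j = - inner ℝ (pd i F y) (pd j n y)) {x : E2} (hx : x ∈ U)
    (hk : k x ≠ 0) (l i j : Fin 2) :
    inner ℝ (pd l F x) (pd i (pd j n) x - ∑ m, christoffel G m i j x • pd m n x)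
      = (1 / 2) * (inner ℝ (pd j F x) (pd l (pd i n) x)
        - inner ℝ (pd l (pd i F) x) (pd j n x)) := by
  have hdet : (G x).det ≠ 0 := by
    rw [h.det_eq hG hx]
    exact mul_ne_zero hk (h.gram_ne_zero x hx)
  -- By symmetry of II the roles of the indices are exchanged before differentiating, which makes
  -- the terms with n_i cancel.
  have hpd : ∀ a b c : Fin 2, pd c (fun y => G y a b) x
      = - (inner ℝ (pd b F x) (pd c (pd a n) x) + inner ℝ (pd c (pd b F) x) (pd a n x)) := by
    intro a b c
    rw [← h.pd_inner_pd hx, ← pd_neg]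
    refine pd_congr_of_eqOn h.isOpen (fun y hy => ?_) hx c
    rw [hG y hy, h.inner_pd_comm hy]
  have hc := sum_mul_christoffel hdet l i j
  rw [hpd, hpd, hpd] at hc
  have hs : inner ℝ (pd l F x) (∑ m, christoffel G m i j x • pd m n x)
      = - ∑ m, G x l m * christoffel G m i j x := by
    rw [inner_sum, ← Finset.sum_neg_distrib]
    refine Finset.sum_congr rfl fun m _ => ?_
    rw [inner_smul_right, hG x hx]
    ring
  rw [inner_sub_right, hs, hc, pd_comm h.isOpen h.smooth_gauss hx j i,
    pd_comm h.isOpen h.smooth_map hx l i, pd_comm h.isOpen h.smooth_map hx l j]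
  ring

/-- The tangential part of the trace of the Hessian of the Gauss map, with respect to the second
fundamental form, is a multiple of the gradient of the curvature. -/
theorem inner_traceHessian (h : IsCoordSurface U F n k)
    (hG : ∀ y ∈ U, ∀ i j, G y i j = - inner ℝ (pd i F y) (pd j n y)) {x : E2} (hx : x ∈ U)
    (hk : k x ≠ 0) (l : Fin 2) :
    inner ℝ (pd l F x) (traceHessian G n x) = - (pd l k x / (2 * k x)) := by
  have hg := h.gram_ne_zero x hx
  have hdet := h.det_eq hG hx
  have hgk := h.gram_mul_pd_curvature hx l
  have hneg : ∀ i j, inner ℝ (pd i F x) (pd j n x) = - G x i j := fun i j => by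
    rw [hG x hx, neg_neg]
  have hT : inner ℝ (pd l F x) (traceHessian G n x)
      = ∑ i, ∑ j, (G x)⁻¹ i j * ((1 / 2) * (inner ℝ (pd j F x) (pd l (pd i n) x)
        - inner ℝ (pd l (pd i F) x) (pd j n x))) := by
    rw [traceHessian, inner_sum]
    refine Finset.sum_congr rfl fun i _ => ?_
    rw [inner_sum]
    refine Finset.sum_congr rfl fun j _ => ?_
    rw [inner_smul_right, h.inner_hessian hG hx hk]
  have hinv : (G x)⁻¹ = (k x * gram F x)⁻¹ • !![G x 1 1, - G x 0 1; - G x 1 0, G x 0 0] := by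
    rw [Matrix.inv_def, hdet, Matrix.adjugate_fin_two, Ring.inverse_eq_inv']
  rw [hneg 1 1, hneg 0 0, hneg 0 1, hneg 1 0] at hgk
  rw [hT, hinv]
  simp only [Fin.sum_univ_two, Matrix.smul_apply, Matrix.of_apply, Matrix.cons_val',
    Matrix.cons_val_zero, Matrix.cons_val_one, Matrix.cons_val_fin_one, smul_eq_mul]
  field_simp
  linear_combination hgk

theorem tension_eq_zero_iff (h : IsCoordSurface U F n k)
    (hG : ∀ y ∈ U, ∀ i j, G y i j = - inner ℝ (pd i F y) (pd j n y)) {x : E2} (hx : x ∈ U)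
    (hk : k x ≠ 0) :
    traceHessian G n x - inner ℝ (n x) (traceHessian G n x) • n x = 0 ↔ ∀ l, pd l k x = 0 := by
  have key : ∀ l, inner ℝ (pd l F x)
      (traceHessian G n x - inner ℝ (n x) (traceHessian G n x) • n x)
      = - (pd l k x / (2 * k x)) := by
    intro l
    rw [inner_sub_right, inner_smul_right, real_inner_comm (n x) (pd l F x), h.normal x hx,
      h.inner_traceHessian hG hx hk]
    ring
  constructor
  · intro h0 l
    have := key l
    rw [h0, inner_zero_right, eq_comm, neg_eq_zero, div_eq_zero_iff] at this
    exact this.resolve_right (mul_ne_zero two_ne_zero hk)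
  · intro h0
    refine eq_zero_of_inner_eq_zero (h.unit x hx) (h.normal x hx 0) (h.normal x hx 1)
      (h.gram_ne_zero x hx) ?_ ?_ ?_
    · rw [key, h0]; simp
    · rw [key, h0]; simp
    · rw [inner_sub_right, inner_smul_right, h.unit x hx]; ring

/-- In Tchebyshev coordinates the curvature has vanishing derivative. -/
theorem pd_curvature_of_tchebyshev (h : IsCoordSurface U F n k)
    (ha : ∀ x ∈ U, ∀ i, inner ℝ (pd i n x) (pd i F x) = 0)
    (hu : ∀ x ∈ U, ∀ i, ‖pd i F x‖ = 1) {x : E2} (hx : x ∈ U) (l : Fin 2) : pd l k x = 0 := by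
  have hF := h.differentiableAt_pd_map hx
  have hn := h.differentiableAt_pd_gauss hx
  have ha' : ∀ y ∈ U, ∀ i, inner ℝ (pd i F y) (pd i n y) = 0 := fun y hy i => by
    rw [real_inner_comm]; exact ha y hy i
  have hunit : ∀ i j, inner ℝ (pd j (pd i F) x) (pd i F x) = 0 := by
    intro i j
    have h1 := pd_congr_of_eqOn (u := fun y => inner ℝ (pd i F y) (pd i F y))
      (v := fun _ => (1 : ℝ)) h.isOpen
      (fun y hy => by simp [hu y hy i]) hx j
    rw [pd_inner (hF i) (hF i), pd_const, real_inner_comm (pd j (pd i F) x) (pd i F x)] at h1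
    linarith
  have hasy : ∀ i j, inner ℝ (pd i F x) (pd j (pd i n) x)
      + inner ℝ (pd j (pd i F) x) (pd i n x) = 0 := by
    intro i j
    have h1 := pd_congr_of_eqOn (v := fun _ => (0 : ℝ)) h.isOpen
      (fun y hy => ha' y hy i) hx j
    rwa [h.pd_inner_pd hx, pd_const] at h1
  have hsym : ∀ j, inner ℝ (pd 0 F x) (pd j (pd 1 n) x) + inner ℝ (pd j (pd 0 F) x) (pd 1 n x)
      = inner ℝ (pd 1 F x) (pd j (pd 0 n) x) + inner ℝ (pd j (pd 1 F) x) (pd 0 n x) := by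
    intro j
    have h1 := pd_congr_of_eqOn h.isOpen (fun y hy => h.inner_pd_comm hy 0 1) hx j
    rwa [h.pd_inner_pd hx, h.pd_inner_pd hx] at h1
  -- F_01 is orthogonal to F_0 and F_1 because both have constant length, and n_j is a combination
  -- of these.
  have hmix : ∀ j, inner ℝ (pd 0 (pd 1 F) x) (pd j n x) = 0 := by
    intro j
    obtain ⟨s, hs, -⟩ := h.weingarten x hx
    have h1 := hunit 1 0
    have h2 := hunit 0 1
    rw [pd_comm h.isOpen h.smooth_map hx] at h2
    rw [hs j, inner_neg_right, inner_add_right, inner_smul_right, inner_smul_right, h1, h2]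
    ring
  have hg := h.gram_mul_pd_curvature hx l
  rw [ha' x hx, ha' x hx, h.inner_pd_comm hx 1 0] at hg
  -- Only the off-diagonal part of the formula for dk survives; its factor vanishes by the
  -- differentiated asymptotic and symmetry identities.
  have hmul : inner ℝ (pd 1 F x) (pd l (pd 0 n) x) - inner ℝ (pd l (pd 0 F) x) (pd 1 n x)
      + (inner ℝ (pd 0 F x) (pd l (pd 1 n) x) - inner ℝ (pd l (pd 1 F) x) (pd 0 n x)) = 0 := by
    have e1 := hasy 1 0
    have e0 := hasy 0 1
    have s := hsym l
    have cF := pd_comm h.isOpen h.smooth_map hx 0 1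
    have cn := pd_comm h.isOpen h.smooth_gauss hx 0 1
    rw [hmix] at e1
    rw [← cF, hmix, ← cn] at e0
    fin_cases l
    · simp only [Fin.zero_eta] at *
      rw [hmix] at *
      linarith
    · simp only [Fin.mk_one] at *
      rw [← cF, ← cn, hmix] at *
      linarith
  have : gram F x * pd l k x = 0 := by
    rw [hg]
    linear_combination (-inner ℝ (pd 0 F x) (pd 1 n x)) * hmul
  exact (mul_eq_zero.1 this).resolve_left (h.gram_ne_zero x hx)

end IsCoordSurface

/-! ### Charts of an immersed surface -/

section Charts

variable {M : Type*} [TopologicalSpace M] [ChartedSpace E2 M]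
  {e : OpenPartialHomeomorph M E2}

theorem mdifferentiableAt_chart_symm (he : e ∈ IsManifold.maximalAtlas (𝓡 2) ∞ M) {x : E2}
    (hx : x ∈ e.target) : MDifferentiableAt 𝓘(ℝ, E2) (𝓡 2) e.symm x :=
  (contMDiffAt_symm_of_mem_maximalAtlas he hx).mdifferentiableAt (by simp)

theorem contDiffOn_comp_chart_symm (he : e ∈ IsManifold.maximalAtlas (𝓡 2) ∞ M) {g : M → E3}
    (hg : ContMDiff (𝓡 2) 𝓘(ℝ, E3) ∞ g) : ContDiffOn ℝ ∞ (g ∘ e.symm) e.target := by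
  rw [← contMDiffOn_iff_contDiffOn]
  exact hg.comp_contMDiffOn (contMDiffOn_symm_of_mem_maximalAtlas he)

theorem fderiv_comp_chart_symm (he : e ∈ IsManifold.maximalAtlas (𝓡 2) ∞ M) {g : M → E3}
    (hg : ContMDiff (𝓡 2) 𝓘(ℝ, E3) ∞ g) {x : E2} (hx : x ∈ e.target) (v : E2) :
    fderiv ℝ (g ∘ e.symm) x v
      = diffAt g (e.symm x) (mfderiv 𝓘(ℝ, E2) (𝓡 2) e.symm x v) := by
  rw [← mfderiv_eq_fderiv, mfderiv_comp x ((hg _).mdifferentiableAt (by simp))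
    (mdifferentiableAt_chart_symm he hx)]
  rfl

theorem mfderiv_chart_symm_injective (he : e ∈ IsManifold.maximalAtlas (𝓡 2) ∞ M) {x : E2}
    (hx : x ∈ e.target) : Function.Injective (mfderiv 𝓘(ℝ, E2) (𝓡 2) e.symm x) := by
  have h1 : MDifferentiableAt (𝓡 2) 𝓘(ℝ, E2) e (e.symm x) :=
    (contMDiffAt_of_mem_maximalAtlas he (e.map_target hx)).mdifferentiableAt (by simp)
  have h2 := mfderiv_comp x h1 (mdifferentiableAt_chart_symm he hx)
  have h3 : (e ∘ e.symm) =ᶠ[nhds x] id :=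
    Filter.eventuallyEq_of_mem (e.open_target.mem_nhds hx) fun y hy => e.right_inv hy
  rw [h3.mfderiv_eq, mfderiv_id] at h2
  refine Function.LeftInverse.injective
    (g := mfderiv (𝓡 2) 𝓘(ℝ, E2) e (e.symm x)) fun v => ?_
  exact (DFunLike.congr_fun h2 v).symm

theorem gram_ne_zero_of_injective {F : E2 → E3} {x : E2}
    (hF : Function.Injective (fderiv ℝ F x)) : gram F x ≠ 0 := by
  intro h0
  have hcomb : ∀ a b : ℝ, a • pd 0 F x + b • pd 1 F x = 0 → a = 0 ∧ b = 0 := by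
    intro a b hab
    have h1 : fderiv ℝ F x (!₂[a, b] : E2) = 0 := by
      rw [clm_apply_eq]
      exact hab
    have h2 : (!₂[a, b] : E2) = 0 := hF (h1.trans (map_zero _).symm)
    exact ⟨by simpa using congrArg (fun v : E2 => v 0) h2,
      by simpa using congrArg (fun v : E2 => v 1) h2⟩
  -- The squared length of this combination is |F_1|² times the Gram determinant.
  have h1 : inner ℝ (pd 1 F x) (pd 1 F x) • pd 0 F x
      + (- inner ℝ (pd 0 F x) (pd 1 F x)) • pd 1 F x = 0 := by
    rw [← inner_self_eq_zero (𝕜 := ℝ)]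
    simp only [inner_add_left, inner_add_right, inner_smul_left, inner_smul_right]
    rw [gram] at h0
    simp only [real_inner_comm (pd 0 F x) (pd 1 F x), conj_trivial]
    linear_combination inner ℝ (pd 1 F x) (pd 1 F x) * h0
  have h2 : pd 1 F x = 0 := inner_self_eq_zero.1 (hcomb _ _ h1).1
  have h3 := hcomb 0 1 (by rw [h2]; simp)
  exact one_ne_zero h3.2

/-- An immersed surface with its Gauss map and Gauss curvature, read in a smooth chart. -/
theorem isCoordSurface_chart {f : M → E3} {N : M → S2} (hf : IsSmoothImmersion f)
    (hN : IsGaussMap f N) (he : e ∈ IsManifold.maximalAtlas (𝓡 2) ∞ M) :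
    IsCoordSurface e.target (f ∘ e.symm) (toE3 N ∘ e.symm) (gaussCurvature f N ∘ e.symm) where
  isOpen := e.open_target
  smooth_map := contDiffOn_comp_chart_symm he hf.smooth
  smooth_gauss := contDiffOn_comp_chart_symm he hN.smooth
  unit x _ := by
    have : ‖toE3 N (e.symm x)‖ = 1 := by simp [toE3]
    simp [this]
  normal x hx i := by
    rw [pd, fderiv_comp_chart_symm he hf.smooth hx]
    exact hN.normal _ _
  gram_ne_zero x hx := by
    refine gram_ne_zero_of_injective fun v w hvw => ?_
    rw [fderiv_comp_chart_symm he hf.smooth hx, fderiv_comp_chart_symm he hf.smooth hx] at hvw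
    exact mfderiv_chart_symm_injective he hx (hf.injective _ hvw)
  weingarten x hx := by
    let L : E2 →ₗ[ℝ] E2 := (mfderiv 𝓘(ℝ, E2) (𝓡 2) e.symm x).toLinearMap
    have hL : Function.Injective L := mfderiv_chart_symm_injective he hx
    let S : E2 →ₗ[ℝ] E2 := shapeOperator f N (e.symm x)
    let L' : E2 ≃ₗ[ℝ] E2 := LinearEquiv.ofInjectiveEndo L hL
    have hL' : ∀ v, L' v = L v := fun v => rfl
    let T : E2 →ₗ[ℝ] E2 := L'.symm.toLinearMap ∘ₗ S ∘ₗ L'.toLinearMap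
    have hT : ∀ v, L (T v) = S (L v) := fun v => L'.apply_symm_apply _
    let b := (EuclideanSpace.basisFun (Fin 2) ℝ).toBasis
    -- The Weingarten matrix is that of the shape operator conjugated by the differential of the
    -- inverse chart, so the determinant is unchanged.
    refine ⟨LinearMap.toMatrix b b T, fun j => ?_, ?_⟩
    · have h1 : ∀ a, LinearMap.toMatrix b b T a j = T (EuclideanSpace.single j 1) a := by
        intro a
        simp [LinearMap.toMatrix_apply, b]
      rw [h1, h1]
      change _ = - ((T (EuclideanSpace.single j 1)) 0 • fderiv ℝ (f ∘ e.symm) x _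
        + (T (EuclideanSpace.single j 1)) 1 • fderiv ℝ (f ∘ e.symm) x _)
      rw [← clm_apply_eq, fderiv_comp_chart_symm he hf.smooth hx, pd,
        fderiv_comp_chart_symm he hN.smooth hx, eq_neg_iff_add_eq_zero, add_comm,
        ← eq_neg_iff_add_eq_zero]
      refine Eq.trans ?_ (diffAt_shapeOperator hf hN _ _)
      exact congrArg (diffAt f (e.symm x)) (hT _)
    · rw [LinearMap.det_toMatrix]
      exact LinearMap.det_conj S L'.symm

theorem coordMatrix_secondForm {f : M → E3} {N : M → S2} (hf : IsSmoothImmersion f)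
    (hN : IsGaussMap f N) (he : e ∈ IsManifold.maximalAtlas (𝓡 2) ∞ M) {x : E2}
    (hx : x ∈ e.target) (i j : Fin 2) :
    coordMatrix (secondForm f N) e x i j
      = - inner ℝ (pd i (f ∘ e.symm) x) (pd j (toE3 N ∘ e.symm) x) := by
  rw [pd, pd, fderiv_comp_chart_symm he hf.smooth hx, fderiv_comp_chart_symm he hN.smooth hx]
  rfl

/-- The tension field of the Gauss map vanishes at a point exactly if the derivative of the
curvature does. -/
theorem tension_eq_zero_iff {f : M → E3} {N : M → S2} (hf : IsSmoothImmersion f)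
    (hN : IsGaussMap f N) (hK : ∀ p, gaussCurvature f N p < 0)
    (he : e ∈ IsManifold.maximalAtlas (𝓡 2) ∞ M) {x : E2} (hx : x ∈ e.target) :
    tension (secondForm f N) N e x = 0 ↔ ∀ l, pd l (gaussCurvature f N ∘ e.symm) x = 0 :=
  (isCoordSurface_chart hf hN he).tension_eq_zero_iff
    (fun _ hy i j => coordMatrix_secondForm hf hN he hy i j) hx (hK _).ne

/-- The curvature is constant as soon as its derivative vanishes in a chart around each point. -/
theorem gaussCurvature_const_of_pd_eq_zero [PreconnectedSpace M] {f : M → E3} {N : M → S2}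
    (hf : IsSmoothImmersion f) (hN : IsGaussMap f N)
    (h : ∀ p : M, ∃ e ∈ IsManifold.maximalAtlas (𝓡 2) ∞ M, p ∈ e.source ∧
      ∀ x ∈ e.target, ∀ l, pd l (gaussCurvature f N ∘ e.symm) x = 0) :
    ∃ c : ℝ, ∀ p, gaussCurvature f N p = c := by
  have hloc : IsLocallyConstant (gaussCurvature f N) := by
    rw [IsLocallyConstant.iff_eventually_eq]
    intro p
    obtain ⟨e, he, hp, h0⟩ := h p
    have hs := (isCoordSurface_chart hf hN he).contDiffOn_curvature
    obtain ⟨ε, hε, hball⟩ := Metric.isOpen_iff.1 e.open_target (e p) (e.map_source hp)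
    have hconst : ∀ y ∈ Metric.ball (e p) ε,
        (gaussCurvature f N ∘ e.symm) y = (gaussCurvature f N ∘ e.symm) (e p) := by
      intro y hy
      refine (convex_ball (e p) ε).is_const_of_fderivWithin_eq_zero (𝕜 := ℝ)
        ((hs.differentiableOn (by simp)).mono hball) (fun z hz => ?_) hy
        (Metric.mem_ball_self hε)
      rw [fderivWithin_of_isOpen Metric.isOpen_ball hz]
      exact fderiv_eq_zero_of_pd (h0 z (hball hz))
    filter_upwards [(e.continuousAt hp).preimage_mem_nhds (Metric.ball_mem_nhds _ hε),
      e.open_source.mem_nhds hp] with q hq hqs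
    have := hconst (e q) hq
    simpa only [Function.comp_apply, e.left_inv hqs, e.left_inv hp] using this
  -- A preconnected space may be empty; any constant then serves.
  rcases isEmpty_or_nonempty M with hM | ⟨⟨p⟩⟩
  · exact ⟨0, fun p => hM.elim p⟩
  · exact ⟨gaussCurvature f N p, fun q => hloc.apply_eq_of_preconnectedSpace q p⟩

end Charts

/-! ### The asymptotic coframe of a surface of constant negative curvature -/

/-- On the tangent plane n × · is a quarter turn, which converts areas into inner products. -/
theorem inner_cross_cross {a b n : E3} (hn : inner ℝ n n = 1) (ha : inner ℝ n a = 0) :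
    inner ℝ n (cross a (cross n b)) = inner ℝ a b := by
  rw [cross_cross, inner_sub_right, inner_smul_right, inner_smul_right, hn,
    real_inner_comm n a, ha]
  ring

theorem inner_cross_cross_cross {a b n : E3} (hn : inner ℝ n n = 1) :
    inner ℝ n (cross (cross n a) (cross n b)) = inner ℝ n (cross a b) := by
  have h1 : inner ℝ n (cross (cross n a) (cross n b))
      = inner ℝ n n * inner ℝ n (cross a b) := by
    simp only [inner_eq, cross_apply_zero, cross_apply_one, cross_apply_two]; ring
  rw [h1, hn, one_mul]

theorem cross_eq_smul_of_inner_eq_zero {a b n : E3} (hn : inner ℝ n n = 1)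
    (ha : inner ℝ n a = 0) (hb : inner ℝ n b = 0) : cross a b = inner ℝ n (cross a b) • n := by
  have h1 := cross_cross n n (cross a b)
  have h2 : cross n (cross a b) = 0 := by
    rw [cross_cross, ha, hb]; simp
  rw [h2, hn, one_smul, map_zero] at h1
  exact (sub_eq_zero.1 h1.symm).symm

theorem pd_cross {u v : E2 → E3} {x : E2} (hu : DifferentiableAt ℝ u x)
    (hv : DifferentiableAt ℝ v x) (i : Fin 2) :
    pd i (fun y => cross (u y) (v y)) x = cross (u x) (pd i v x) + cross (pd i u x) (v x) := by
  have h1 := (cross.hasFDerivAt_of_bilinear hu.hasFDerivAt hv.hasFDerivAt).fderiv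
  simp only [pd]
  rw [h1]
  rfl

/-- Twice the projection of `dF` to one of the two asymptotic directions, where `r ^ 2 = -1 / k`
and the sign of `r` selects the direction. -/
def asymptoticForm (F n : E2 → E3) (r : ℝ) (i : Fin 2) (x : E2) : E3 :=
  pd i F x + r • cross (n x) (pd i n x)

namespace IsCoordSurface

variable {U : Set E2} {F n : E2 → E3} {k : E2 → ℝ} {r : ℝ}

theorem contDiffOn_asymptoticForm (h : IsCoordSurface U F n k) (r : ℝ) (i : Fin 2) :
    ContDiffOn ℝ ∞ (asymptoticForm F n r i) U :=
  (contDiffOn_pd h.isOpen h.smooth_map i).add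
    (((cross.contDiff.comp_contDiffOn h.smooth_gauss).clm_apply
      (contDiffOn_pd h.isOpen h.smooth_gauss i)).const_smul r)

theorem inner_gauss_asymptoticForm (h : IsCoordSurface U F n k) {x : E2} (hx : x ∈ U)
    (r : ℝ) (i : Fin 2) : inner ℝ (n x) (asymptoticForm F n r i x) = 0 := by
  rw [asymptoticForm, inner_add_right, inner_smul_right, h.normal x hx, inner_cross_self_left]
  ring

theorem inner_cross_pd_gauss (h : IsCoordSurface U F n k) {x : E2} (hx : x ∈ U) :
    inner ℝ (n x) (cross (pd 0 n x) (pd 1 n x))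
      = k x * inner ℝ (n x) (cross (pd 0 F x) (pd 1 F x)) := by
  obtain ⟨s, hs, hk⟩ := h.weingarten x hx
  rw [hs, hs, ← hk, Matrix.det_fin_two]
  simp only [map_neg, map_add, map_smul, neg_apply, add_apply, smul_apply, inner_neg_right,
    inner_add_right, inner_smul_right, cross_self, cross_anticomm (pd 1 F x) (pd 0 F x),
    inner_zero_right]
  ring

/-- The rank-one property: the normal component is (1 + r²k) times the area of F_0, F_1, as the
terms linear in r cancel by symmetry of II. -/
theorem cross_asymptoticForm (h : IsCoordSurface U F n k) {x : E2} (hx : x ∈ U)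
    (hr : r ^ 2 * k x = -1) :
    cross (asymptoticForm F n r 0 x) (asymptoticForm F n r 1 x) = 0 := by
  have hn := h.unit x hx
  rw [cross_eq_smul_of_inner_eq_zero hn (h.inner_gauss_asymptoticForm hx r 0)
    (h.inner_gauss_asymptoticForm hx r 1)]
  suffices h0 : inner ℝ (n x) (cross (asymptoticForm F n r 0 x) (asymptoticForm F n r 1 x)) = 0 by
    rw [h0, zero_smul]
  simp only [asymptoticForm, map_add, map_smul, add_apply, smul_apply, inner_add_right,
    inner_smul_right]
  rw [inner_cross_cross_cross hn, inner_cross_cross hn (h.normal x hx 0),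
    cross_anticomm (cross (n x) (pd 0 n x)), inner_neg_right,
    inner_cross_cross hn (h.normal x hx 1), h.inner_cross_pd_gauss hx, h.inner_pd_comm hx 0 1]
  linear_combination inner ℝ (n x) (cross (pd 0 F x) (pd 1 F x)) * hr

/-- If both components vanished, F_i = -r n × n_i would make II antisymmetric; being symmetric, it
would be zero, against det II = k det I ≠ 0. -/
theorem exists_asymptoticForm_ne_zero (h : IsCoordSurface U F n k) {x : E2} (hx : x ∈ U)
    (hk : k x ≠ 0) (r : ℝ) : ∃ j, asymptoticForm F n r j x ≠ 0 := by
  by_contra! h0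
  have hF : ∀ i, pd i F x = (-r) • cross (n x) (pd i n x) := by
    intro i
    have h1 := h0 i
    rw [asymptoticForm] at h1
    rw [neg_smul]
    exact eq_neg_of_add_eq_zero_left h1
  have hij : ∀ i j, inner ℝ (pd i F x) (pd j n x)
      = -r * inner ℝ (pd j n x) (cross (n x) (pd i n x)) := by
    intro i j
    rw [hF, inner_smul_left, real_inner_comm]
    rfl
  have hself : ∀ i, inner ℝ (pd i F x) (pd i n x) = 0 := by
    intro i
    rw [hij, inner_cross_self_right, mul_zero]
  have hanti : inner ℝ (pd 0 F x) (pd 1 n x) = - inner ℝ (pd 1 F x) (pd 0 n x) := by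
    rw [hij, hij, inner_cross_rotate, cross_anticomm, inner_neg_right,
      inner_cross_rotate (n x), inner_cross_rotate]
    rw [inner_cross_rotate (pd 0 n x)]
    ring
  have hs := h.inner_pd_comm hx 0 1
  have hd := h.det_second hx
  rw [hself, hself, hanti] at hd
  have h1 : inner ℝ (pd 1 F x) (pd 0 n x) = 0 := by linarith
  rw [h1] at hd
  exact mul_ne_zero hk (h.gram_ne_zero x hx) (by rw [← hd]; ring)

/-- The exterior derivative is purely normal: dF is closed and d(n × dn) is twice n_0 × n_1.
Constancy of r, hence of K in the application, is essential. -/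
theorem exists_pd_asymptoticForm_sub_eq_smul (h : IsCoordSurface U F n k) {x : E2} (hx : x ∈ U)
    (r : ℝ) : ∃ c : ℝ, pd 0 (asymptoticForm F n r 1) x - pd 1 (asymptoticForm F n r 0) x
      = c • n x := by
  have hn := h.differentiableAt_gauss hx
  have hpd : ∀ i j, pd i (asymptoticForm F n r j) x = pd i (pd j F) x
      + r • (cross (n x) (pd i (pd j n) x) + cross (pd i n x) (pd j n x)) := by
    intro i j
    have hc : DifferentiableAt ℝ (fun y => cross (n y) (pd j n y)) x :=
      (cross.differentiableAt.comp x hn).clm_apply (h.differentiableAt_pd_gauss hx j)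
    change pd i (fun y => pd j F y + r • cross (n y) (pd j n y)) x = _
    rw [pd_add (h.differentiableAt_pd_map hx j) (hc.fun_const_smul r), pd_const_smul hc,
      pd_cross hn (h.differentiableAt_pd_gauss hx j)]
  refine ⟨2 * r * inner ℝ (n x) (cross (pd 0 n x) (pd 1 n x)), ?_⟩
  rw [hpd, hpd, pd_comm h.isOpen h.smooth_map hx 0 1, pd_comm h.isOpen h.smooth_gauss hx 0 1,
    cross_anticomm (pd 1 n x), mul_smul, ← cross_eq_smul_of_inner_eq_zero (h.unit x hx)
      (h.inner_gauss_pd_gauss hx 0) (h.inner_gauss_pd_gauss hx 1)]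
  module

/-- On a surface of constant negative curvature, each of the two asymptotic projections of `dF`
is, locally, a unit vector field times a closed one-form. -/
theorem exists_closed_form (h : IsCoordSurface U F n k) (hr : ∀ x ∈ U, r ^ 2 * k x = -1)
    {x₀ : E2} (hx₀ : x₀ ∈ U) :
    ∃ V ⊆ U, IsOpen V ∧ x₀ ∈ V ∧ ∃ (u : E2 → E3) (α : Fin 2 → E2 → ℝ),
      (∀ i, ContDiffOn ℝ ∞ (α i) V) ∧ (∀ x ∈ V, ‖u x‖ = 1) ∧
      (∀ x ∈ V, ∀ i, asymptoticForm F n r i x = (2 * α i x) • u x) ∧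
      ∀ x ∈ V, pd 0 (α 1) x = pd 1 (α 0) x := by
  have hk : ∀ x ∈ U, k x ≠ 0 := by
    intro x hx h0
    have := hr x hx
    rw [h0] at this
    norm_num at this
  obtain ⟨j, hj⟩ := h.exists_asymptoticForm_ne_zero hx₀ (hk x₀ hx₀) r
  set A := asymptoticForm F n r with hA
  have hAs : ∀ i, ContDiffOn ℝ ∞ (A i) U := h.contDiffOn_asymptoticForm r
  -- Where the component A_j is nonzero, its normalisation supplies the unit field u.
  let V : Set E2 := U ∩ A j ⁻¹' {0}ᶜ
  have hVU : V ⊆ U := Set.inter_subset_left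
  have hV : IsOpen V := (hAs j).continuousOn.isOpen_inter_preimage h.isOpen isOpen_compl_singleton
  have hV0 : ∀ x ∈ V, A j x ≠ 0 := fun x hx => hx.2
  let u : E2 → E3 := fun x => ‖A j x‖⁻¹ • A j x
  have hus : ContDiffOn ℝ ∞ u V :=
    ((((hAs j).mono hVU).norm ℝ hV0).inv fun x hx => norm_ne_zero_iff.2 (hV0 x hx)).smul
      ((hAs j).mono hVU)
  have hu1 : ∀ x ∈ V, ‖u x‖ = 1 := fun x hx => by
    simp only [u, norm_smul, norm_inv, norm_norm]
    exact inv_mul_cancel₀ (norm_ne_zero_iff.2 (hV0 x hx))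
  have hun : ∀ x ∈ V, inner ℝ (n x) (u x) = 0 := fun x hx => by
    simp only [u, inner_smul_right]
    rw [h.inner_gauss_asymptoticForm (hVU hx), mul_zero]
  have hpar : ∀ x ∈ V, ∀ i, A i x = inner ℝ (A i x) (u x) • u x := by
    intro x hx i
    have hcr : cross (A i x) (A j x) = 0 := by
      have h01 := h.cross_asymptoticForm (hVU hx) (hr x (hVU hx))
      fin_cases i <;> fin_cases j
      · exact cross_self _
      · exact h01
      · exact (cross_anticomm _ _).trans (by rw [neg_eq_zero]; exact h01)
      · exact cross_self _
    have h2 := cross_cross (A j x) (A i x) (A j x)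
    rw [hcr, map_zero, eq_comm, sub_eq_zero, real_inner_self_eq_norm_sq] at h2
    have hne : ‖A j x‖ ≠ 0 := norm_ne_zero_iff.2 (hV0 x hx)
    simp only [u, inner_smul_right, smul_smul]
    rw [show ‖A j x‖⁻¹ * inner ℝ (A i x) (A j x) * ‖A j x‖⁻¹
        = (‖A j x‖ ^ 2)⁻¹ * inner ℝ (A j x) (A i x) by rw [real_inner_comm]; field_simp,
      mul_smul, ← h2, smul_smul, inv_mul_cancel₀ (pow_ne_zero 2 hne), one_smul]
  refine ⟨V, hVU, hV, ⟨hx₀, hj⟩, u,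
    fun i x => (1 / 2 : ℝ) * inner ℝ (A i x) (u x), ?_, hu1, ?_, ?_⟩
  · exact fun i => contDiffOn_const.mul (((hAs i).mono hVU).inner ℝ hus)
  · intro x hx i
    rw [← mul_assoc, show (2 : ℝ) * (1 / 2) = 1 by norm_num, one_mul]
    exact hpar x hx i
  · intro x hx
    have hAd : ∀ i, DifferentiableAt ℝ (A i) x := fun i =>
      differentiableAt_of_contDiffOn h.isOpen (hAs i) (hVU hx)
    have hud : DifferentiableAt ℝ u x := differentiableAt_of_contDiffOn hV hus hx
    have huu : ∀ i, inner ℝ (u x) (pd i u x) = 0 := by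
      intro i
      have h1 := pd_congr_of_eqOn (u := fun y => inner ℝ (u y) (u y)) (v := fun _ => (1 : ℝ)) hV
        (fun y hy => by simp [hu1 y hy]) hx i
      rw [pd_inner hud hud, pd_const, real_inner_comm (u x) (pd i u x)] at h1
      linarith
    -- A_i is parallel to u, and u is orthogonal to its own derivatives, so differentiating ⟨A_i, u⟩
    -- only differentiates A_i.
    have hAu : ∀ i j, inner ℝ (A i x) (pd j u x) = 0 := by
      intro i j
      rw [hpar x hx i, inner_smul_left, huu, mul_zero]
    have hpd : ∀ i j, pd i (fun y => (1 / 2 : ℝ) * inner ℝ (A j y) (u y)) x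
        = (1 / 2) * inner ℝ (pd i (A j) x) (u x) := by
      intro i j
      rw [pd_mul (differentiableAt_const _) ((hAd j).inner ℝ hud), pd_const,
        pd_inner (hAd j) hud, hAu]
      ring
    obtain ⟨c, hc⟩ := h.exists_pd_asymptoticForm_sub_eq_smul (hVU hx) r
    have h1 : inner ℝ (pd 0 (A 1) x - pd 1 (A 0) x) (u x) = 0 := by
      rw [hc, inner_smul_left, hun x hx, mul_zero]
    rw [inner_sub_left] at h1
    rw [hpd, hpd]
    linarith

end IsCoordSurface

/-! ### Potentials and changes of coordinates -/

/-- A closed one-form on a convex open set of the plane is exact. -/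
theorem exists_potential {V : Set E2} (hV : IsOpen V) (hc : Convex ℝ V) {α : Fin 2 → E2 → ℝ}
    (hα : ∀ i, ContDiffOn ℝ ∞ (α i) V) (hcl : ∀ x ∈ V, pd 0 (α 1) x = pd 1 (α 0) x) :
    ∃ ξ : E2 → ℝ, ContDiffOn ℝ ∞ ξ V ∧ ∀ x ∈ V, ∀ i, pd i ξ x = α i x := by
  let P : Fin 2 → E2 →L[ℝ] ℝ := fun i => EuclideanSpace.proj i
  let θ : E2 → E2 →L[ℝ] ℝ := fun x => α 0 x • P 0 + α 1 x • P 1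
  have hθ : ContDiffOn ℝ ∞ θ V :=
    ((hα 0).smul contDiffOn_const).add ((hα 1).smul contDiffOn_const)
  have hsymm : ∀ a ∈ V, ∀ x y, fderiv ℝ θ a x y = fderiv ℝ θ a y x := by
    intro a ha x y
    have hd : ∀ i, HasFDerivAt (α i) (fderiv ℝ (α i) a) a := fun i =>
      (differentiableAt_of_contDiffOn hV (hα i) ha).hasFDerivAt
    have h1 : HasFDerivAt θ _ a := ((hd 0).smul_const (P 0)).add ((hd 1).smul_const (P 1))
    have h2 : ∀ v w : E2, fderiv ℝ θ a v w
        = fderiv ℝ (α 0) a v * w 0 + fderiv ℝ (α 1) a v * w 1 := by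
      intro v w
      rw [h1.fderiv]
      rfl
    have h3 := hcl a ha
    simp only [pd] at h3
    rw [h2, h2]
    simp only [clm_apply_eq (fderiv ℝ (α _) a) x, clm_apply_eq (fderiv ℝ (α _) a) y, h3,
      smul_eq_mul]
    ring
  obtain ⟨ξ, hξ⟩ := hc.exists_forall_hasFDerivAt_of_fderiv_symmetric hV
    (hθ.differentiableOn (by simp)) hsymm
  refine ⟨ξ, ?_, fun x hx i => ?_⟩
  -- The potential is smooth because its derivative is the smooth form θ.
  · rw [contDiffOn_infty_iff_fderiv_of_isOpen hV]
    exact ⟨fun x hx => (hξ x hx).differentiableAt.differentiableWithinAt,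
      hθ.congr fun x hx => (hξ x hx).fderiv⟩
  · rw [pd, (hξ x hx).fderiv]
    change α 0 x * (EuclideanSpace.single i (1 : ℝ) : E2) 0
      + α 1 x * (EuclideanSpace.single i (1 : ℝ) : E2) 1 = _
    fin_cases i <;> simp

theorem fderiv_apply_coord {Φ : E2 → E2} {x : E2} (h : DifferentiableAt ℝ Φ x) (v : E2)
    (i : Fin 2) : fderiv ℝ Φ x v i = fderiv ℝ (fun y => Φ y i) x v := by
  have h1 : HasFDerivAt (fun y => Φ y i) _ x :=
    ((EuclideanSpace.proj i : E2 →L[ℝ] ℝ).hasFDerivAt).comp x h.hasFDerivAt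
  rw [h1.fderiv]
  rfl

/-- Two functions with independent differentials are coordinates near each point. -/
theorem exists_coordinates {V : Set E2} (hV : IsOpen V) {ξ η : E2 → ℝ}
    (hξ : ContDiffOn ℝ ∞ ξ V) (hη : ContDiffOn ℝ ∞ η V)
    (hJ : ∀ x ∈ V, pd 0 ξ x * pd 1 η x - pd 1 ξ x * pd 0 η x ≠ 0) {x₀ : E2} (hx₀ : x₀ ∈ V) :
    ∃ φ : OpenPartialHomeomorph E2 E2, x₀ ∈ φ.source ∧ φ.source ⊆ V ∧
      ContDiffOn ℝ ∞ φ φ.source ∧ ContDiffOn ℝ ∞ φ.symm φ.target ∧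
      ∀ x, φ x = !₂[ξ x, η x] := by
  let Φ : E2 → E2 := fun x => !₂[ξ x, η x]
  have hΦ : ContDiffOn ℝ ∞ Φ V := by
    rw [contDiffOn_euclidean]
    intro i
    fin_cases i
    · exact hξ
    · exact hη
  have hd : ∀ x ∈ V, HasFDerivAt Φ (fderiv ℝ Φ x) x := fun x hx =>
    (differentiableAt_of_contDiffOn hV hΦ hx).hasFDerivAt
  have hcomp : ∀ x ∈ V, ∀ v : E2, fderiv ℝ Φ x v = !₂[fderiv ℝ ξ x v, fderiv ℝ η x v] := by
    intro x hx v
    ext i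
    rw [fderiv_apply_coord (hd x hx).differentiableAt]
    fin_cases i <;> rfl
  have hinj : ∀ x ∈ V, Function.Injective (fderiv ℝ Φ x : E2 →ₗ[ℝ] E2) := by
    intro x hx
    rw [← LinearMap.ker_eq_bot, LinearMap.ker_eq_bot']
    intro v hv
    have h1 : (!₂[fderiv ℝ ξ x v, fderiv ℝ η x v] : E2) = 0 := (hcomp x hx v).symm.trans hv
    have e0 : fderiv ℝ ξ x v = 0 := by simpa using congrArg (fun w : E2 => w 0) h1
    have e1 : fderiv ℝ η x v = 0 := by simpa using congrArg (fun w : E2 => w 1) h1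
    rw [clm_apply_eq] at e0 e1
    change v 0 * pd 0 ξ x + v 1 * pd 1 ξ x = 0 at e0
    change v 0 * pd 0 η x + v 1 * pd 1 η x = 0 at e1
    have f0 : v 0 = 0 := by
      refine (mul_eq_zero.1 ?_).resolve_left (hJ x hx)
      linear_combination pd 1 η x * e0 - pd 1 ξ x * e1
    have f1 : v 1 = 0 := by
      refine (mul_eq_zero.1 ?_).resolve_left (hJ x hx)
      linear_combination pd 0 ξ x * e1 - pd 0 η x * e0
    ext i
    fin_cases i
    · exact f0
    · exact f1
  let L : ∀ x ∈ V, E2 ≃L[ℝ] E2 := fun x hx =>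
    (LinearEquiv.ofInjectiveEndo _ (hinj x hx)).toContinuousLinearEquiv
  have hL : ∀ x (hx : x ∈ V), HasFDerivAt Φ (L x hx : E2 →L[ℝ] E2) x := by
    intro x hx
    have : (L x hx : E2 →L[ℝ] E2) = fderiv ℝ Φ x := by ext; rfl
    rw [this]
    exact hd x hx
  have hat : ∀ x ∈ V, ContDiffAt ℝ ∞ Φ x := fun x hx => hΦ.contDiffAt (hV.mem_nhds hx)
  let ψ := (hat x₀ hx₀).toOpenPartialHomeomorph Φ (hL x₀ hx₀) (by simp)
  have hψ : ∀ x, ψ x = Φ x := fun x => rfl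
  -- Inside V the differential is invertible everywhere, so the local inverse is smooth on the whole
  -- target.
  let φ := ψ.restrOpen V hV
  have hsrc : φ.source = ψ.source ∩ V := ψ.restrOpen_source V hV
  have hφV : φ.source ⊆ V := by rw [hsrc]; exact Set.inter_subset_right
  refine ⟨φ, ?_, hφV, hΦ.mono hφV, fun y hy => ?_, fun x => rfl⟩
  · rw [hsrc]
    exact ⟨(hat x₀ hx₀).mem_toOpenPartialHomeomorph_source (hL x₀ hx₀) (by simp), hx₀⟩
  · have hyV := hφV (φ.map_target hy)
    exact (φ.contDiffAt_symm hy (hL _ hyV) (hat _ hyV)).contDiffWithinAt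

/-- The chain rule, with the old derivatives expressed by the new ones, so that Cramer's rule
suffices and the inverse Jacobian is never computed. -/
theorem pd_eq_of_coordinates {φ : OpenPartialHomeomorph E2 E2} {ξ η : E2 → ℝ}
    (hφ : ∀ x, φ x = !₂[ξ x, η x]) (hs : ContDiffOn ℝ ∞ φ φ.source)
    (hs' : ContDiffOn ℝ ∞ φ.symm φ.target) {g : E2 → E3} {x : E2} (hx : x ∈ φ.source)
    (hg : DifferentiableAt ℝ g x) (j : Fin 2) :
    pd j g x = pd j ξ x • pd 0 (g ∘ φ.symm) (φ x) + pd j η x • pd 1 (g ∘ φ.symm) (φ x) := by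
  have hd := differentiableAt_of_contDiffOn φ.open_source hs hx
  have hd' := differentiableAt_of_contDiffOn φ.open_target hs' (φ.map_source hx)
  have hg' : DifferentiableAt ℝ (g ∘ φ.symm) (φ x) := by
    refine DifferentiableAt.comp (φ x) ?_ hd'
    rwa [φ.left_inv hx]
  have h1 : pd j g x = pd j ((g ∘ φ.symm) ∘ φ) x :=
    pd_congr_of_eqOn φ.open_source
      (fun y hy => by simp only [Function.comp_apply, φ.left_inv hy]) hx j
  rw [h1, pd, fderiv_comp x hg' hd, ContinuousLinearMap.comp_apply, clm_apply_eq,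
    fderiv_apply_coord hd, fderiv_apply_coord hd]
  simp only [hφ]
  rfl

/-- Cramer's rule for a pair of vectors. -/
theorem eq_and_eq_of_combination_eq {a b c d : ℝ} (hJ : a * d - c * b ≠ 0) {p q u v : E3}
    (h0 : a • p + b • q = a • u + b • v) (h1 : c • p + d • q = c • u + d • v) :
    p = u ∧ q = v := by
  constructor
  · have : (a * d - c * b) • (p - u) = 0 := by
      linear_combination (norm := module) d • h0 - b • h1
    exact sub_eq_zero.1 ((smul_eq_zero.1 this).resolve_left hJ)
  · have : (a * d - c * b) • (q - v) = 0 := by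
      linear_combination (norm := module) a • h1 - c • h0
    exact sub_eq_zero.1 ((smul_eq_zero.1 this).resolve_left hJ)

/-- A surface of constant negative curvature has Tchebyshev coordinates near each point. -/
theorem IsCoordSurface.exists_tchebyshev {U : Set E2} {F n : E2 → E3} {k : E2 → ℝ} {c : ℝ}
    (h : IsCoordSurface U F n k) (hc : c < 0) (hk : ∀ x ∈ U, k x = c) {x₀ : E2} (hx₀ : x₀ ∈ U) :
    ∃ φ : OpenPartialHomeomorph E2 E2, x₀ ∈ φ.source ∧ φ.source ⊆ U ∧
      ContDiffOn ℝ ∞ φ φ.source ∧ ContDiffOn ℝ ∞ φ.symm φ.target ∧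
      ∀ y ∈ φ.target, ∀ i, inner ℝ (pd i (n ∘ φ.symm) y) (pd i (F ∘ φ.symm) y) = 0 ∧
        ‖pd i (F ∘ φ.symm) y‖ = 1 := by
  set r : ℝ := (Real.sqrt (-c))⁻¹ with hrdef
  have hrc : r ^ 2 * c = -1 := by
    rw [hrdef, inv_pow, Real.sq_sqrt (by linarith), inv_neg, neg_mul, inv_mul_cancel₀ hc.ne]
  have hr0 : r ≠ 0 := by
    intro h0
    rw [h0] at hrc
    norm_num at hrc
  obtain ⟨V₁, hV₁U, hV₁, hx₁, u, α, hα, hu, hAα, hclα⟩ :=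
    h.exists_closed_form (r := r) (fun x hx => by rw [hk x hx, hrc]) hx₀
  obtain ⟨V₂, hV₂U, hV₂, hx₂, v, β, hβ, hv, hAβ, hclβ⟩ :=
    h.exists_closed_form (r := -r) (fun x hx => by rw [hk x hx, neg_sq, hrc]) hx₀
  -- A ball is convex, so both closed forms have potentials on it.
  obtain ⟨ε, hε, hball⟩ := Metric.isOpen_iff.1 (hV₁.inter hV₂) x₀ ⟨hx₁, hx₂⟩
  set B := Metric.ball x₀ ε
  have hB₁ : B ⊆ V₁ := fun x hx => (hball hx).1
  have hB₂ : B ⊆ V₂ := fun x hx => (hball hx).2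
  have hBU : B ⊆ U := hB₁.trans hV₁U
  obtain ⟨ξ, hξ, hξα⟩ := exists_potential (V := B) Metric.isOpen_ball (convex_ball _ _)
    (fun i => (hα i).mono hB₁) fun x hx => hclα x (hB₁ hx)
  obtain ⟨η, hη, hηβ⟩ := exists_potential (V := B) Metric.isOpen_ball (convex_ball _ _)
    (fun i => (hβ i).mono hB₂) fun x hx => hclβ x (hB₂ hx)
  have hF : ∀ x ∈ B, ∀ i, pd i F x = α i x • u x + β i x • v x := by
    intro x hx i
    have h1 := hAα x (hB₁ hx) i
    have h2 := hAβ x (hB₂ hx) i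
    rw [asymptoticForm] at h1 h2
    linear_combination (norm := module) (1 / 2 : ℝ) • h1 + (1 / 2 : ℝ) • h2
  have hn : ∀ x ∈ B, ∀ i, r • cross (n x) (pd i n x) = α i x • u x + β i x • (- v x) := by
    intro x hx i
    have h1 := hAα x (hB₁ hx) i
    have h2 := hAβ x (hB₂ hx) i
    rw [asymptoticForm] at h1 h2
    linear_combination (norm := module) (1 / 2 : ℝ) • h1 - (1 / 2 : ℝ) • h2
  -- The Gram determinant of F is the square of this Jacobian times that of u, v, so immersivity
  -- excludes zero.
  have hJ : ∀ x ∈ B, α 0 x * β 1 x - α 1 x * β 0 x ≠ 0 := by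
    intro x hx h0
    refine h.gram_ne_zero x (hBU hx) ?_
    rw [gram, hF x hx, hF x hx]
    simp only [inner_add_left, inner_add_right, inner_smul_left, inner_smul_right, conj_trivial,
      real_inner_comm (u x) (v x)]
    linear_combination (α 0 x * β 1 x - α 1 x * β 0 x)
      * (inner ℝ (u x) (u x) * inner ℝ (v x) (v x) - inner ℝ (u x) (v x) ^ 2) * h0
  obtain ⟨φ, hφ₀, hφB, hφs, hφs', hφ⟩ := exists_coordinates (V := B) Metric.isOpen_ball hξ hη
    (fun x hx => by rw [hξα x hx, hξα x hx, hηβ x hx, hηβ x hx]; exact hJ x hx)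
    (Metric.mem_ball_self hε)
  refine ⟨φ, hφ₀, hφB.trans hBU, hφs, hφs', fun y hy => ?_⟩
  obtain ⟨x, hx, rfl⟩ : ∃ x ∈ φ.source, φ x = y := ⟨_, φ.map_target hy, φ.right_inv hy⟩
  have hxB := hφB hx
  have hFc : ∀ j, α j x • pd 0 (F ∘ φ.symm) (φ x) + β j x • pd 1 (F ∘ φ.symm) (φ x)
      = α j x • u x + β j x • v x := fun j => by
    rw [← hF x hxB, pd_eq_of_coordinates hφ hφs hφs' hx (h.differentiableAt_map (hBU hxB)),
      hξα x hxB, hηβ x hxB]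
  have hnc : ∀ j, α j x • (r • cross (n x) (pd 0 (n ∘ φ.symm) (φ x)))
      + β j x • (r • cross (n x) (pd 1 (n ∘ φ.symm) (φ x)))
      = α j x • u x + β j x • (- v x) := fun j => by
    rw [← hn x hxB, pd_eq_of_coordinates hφ hφs hφs' hx (h.differentiableAt_gauss (hBU hxB)),
      hξα x hxB, hηβ x hxB]
    simp only [map_add, map_smul, smul_add]
    rw [smul_comm r, smul_comm r]
  obtain ⟨hFξ, hFη⟩ := eq_and_eq_of_combination_eq (hJ x hxB) (hFc 0) (hFc 1)
  obtain ⟨hnξ, hnη⟩ := eq_and_eq_of_combination_eq (hJ x hxB) (hnc 0) (hnc 1)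
  intro i
  fin_cases i
  · refine ⟨?_, ?_⟩
    · change inner ℝ (pd 0 (n ∘ φ.symm) (φ x)) (pd 0 (F ∘ φ.symm) (φ x)) = 0
      rw [hFξ, ← hnξ, inner_smul_right, inner_cross_self_right, mul_zero]
    · change ‖pd 0 (F ∘ φ.symm) (φ x)‖ = 1
      rw [hFξ, hu x (hB₁ hxB)]
  · refine ⟨?_, ?_⟩
    · change inner ℝ (pd 1 (n ∘ φ.symm) (φ x)) (pd 1 (F ∘ φ.symm) (φ x)) = 0
      rw [hFη, ← neg_neg (v x), ← hnη, inner_neg_right, inner_smul_right,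
        inner_cross_self_right, mul_zero, neg_zero]
    · change ‖pd 1 (F ∘ φ.symm) (φ x)‖ = 1
      rw [hFη, hv x (hB₂ hxB)]

/-! ### Tchebyshev charts on the surface -/

section Charts

variable {M : Type*} [TopologicalSpace M] [ChartedSpace E2 M] [IsManifold (𝓡 2) ∞ M]

theorem trans_mem_maximalAtlas {e : OpenPartialHomeomorph M E2}
    (he : e ∈ IsManifold.maximalAtlas (𝓡 2) ∞ M) {φ : OpenPartialHomeomorph E2 E2}
    (hs : ContDiffOn ℝ ∞ φ φ.source) (hs' : ContDiffOn ℝ ∞ φ.symm φ.target) :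
    e.trans φ ∈ IsManifold.maximalAtlas (𝓡 2) ∞ M := by
  refine OpenPartialHomeomorph.mem_maximalAtlas_of_contMDiffOn _ ?_ ?_
  · exact (contMDiffOn_iff_contDiffOn.2 hs).comp
      ((contMDiffOn_of_mem_maximalAtlas he).mono fun p hp => hp.1) fun p hp => hp.2
  · refine (contMDiffOn_symm_of_mem_maximalAtlas he).comp
      ((contMDiffOn_iff_contDiffOn.2 hs').mono fun y hy => ?_) fun y hy => ?_
    · rw [OpenPartialHomeomorph.trans_target] at hy
      exact hy.1
    · rw [OpenPartialHomeomorph.trans_target] at hy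
      exact hy.2

theorem exists_isTchebyshev {f : M → E3} {N : M → S2} (hf : IsSmoothImmersion f)
    (hN : IsGaussMap f N) {c : ℝ} (hc : c < 0) (hK : ∀ p, gaussCurvature f N p = c) (p : M) :
    ∃ e ∈ IsManifold.maximalAtlas (𝓡 2) ∞ M, p ∈ e.source ∧ IsTchebyshev f N e := by
  have he := IsManifold.chart_mem_maximalAtlas (I := 𝓡 2) (n := ∞) p
  set e := chartAt E2 p
  have hp : p ∈ e.source := mem_chart_source E2 p
  obtain ⟨φ, hφ₀, -, hs, hs', hT⟩ := (isCoordSurface_chart hf hN he).exists_tchebyshev hc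
    (fun x _ => hK _) (e.map_source hp)
  have ht : ∀ y ∈ (e.trans φ).target, y ∈ φ.target := fun y hy => by
    rw [OpenPartialHomeomorph.trans_target] at hy
    exact hy.1
  refine ⟨e.trans φ, trans_mem_maximalAtlas he hs hs', ?_, fun y hy i => ?_, fun y hy i => ?_⟩
  · rw [OpenPartialHomeomorph.trans_source]
    exact ⟨hp, hφ₀⟩
  · exact (hT y (ht y hy) i).1
  · exact (hT y (ht y hy) i).2

end Charts

end KSurface

end

theorem mainTheorem1 {M : Type*} [TopologicalSpace M] [ChartedSpace KSurface.E2 M]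
    [IsManifold (𝓡 2) ∞ M] [PreconnectedSpace M]
    (f : M → KSurface.E3) (N : M → KSurface.S2)
    (hf : KSurface.IsSmoothImmersion f) (hN : KSurface.IsGaussMap f N)
    (hK : ∀ p, KSurface.gaussCurvature f N p < 0) :
    List.TFAE [
      ∃ c : ℝ, ∀ p, KSurface.gaussCurvature f N p = c,
      KSurface.IsHarmonic (KSurface.secondForm f N) N,
      ∀ p : M, ∃ e ∈ IsManifold.maximalAtlas (𝓡 2) ∞ M,
        p ∈ e.source ∧ KSurface.IsTchebyshev f N e] := by
  tfae_have 1 → 2 := by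
    rintro ⟨c, hc⟩ e he x hx
    rw [KSurface.tension_eq_zero_iff hf hN hK he hx]
    intro l
    have hconst : KSurface.gaussCurvature f N ∘ e.symm = fun _ => c := funext fun y => hc _
    rw [hconst, KSurface.pd_const]
  tfae_have 2 → 1 := fun h =>
    KSurface.gaussCurvature_const_of_pd_eq_zero hf hN fun p =>
      ⟨chartAt KSurface.E2 p, IsManifold.chart_mem_maximalAtlas p, mem_chart_source _ p,
        fun x hx => (KSurface.tension_eq_zero_iff hf hN hK
          (IsManifold.chart_mem_maximalAtlas p) hx).1
          (h _ (IsManifold.chart_mem_maximalAtlas p) x hx)⟩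
  tfae_have 1 → 3 := by
    rintro ⟨c, hc⟩ p
    exact KSurface.exists_isTchebyshev hf hN (hc p ▸ hK p) hc p
  tfae_have 3 → 1 := fun h =>
    KSurface.gaussCurvature_const_of_pd_eq_zero hf hN fun p => by
      obtain ⟨e, he, hp, ha, hu⟩ := h p
      exact ⟨e, he, hp, fun x hx l =>
        (KSurface.isCoordSurface_chart hf hN he).pd_curvature_of_tchebyshev ha hu hx l⟩
  tfae_finish
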